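/- Let $n\ge 3$ and let $p$ be a closed polygonal line in $\mathbb R^3$ with vertices $V_0,\dots,V_{n-1}$ (indices modulo $n$) such that $V_{i-1},V_i,V_{i+1}$ are never collinear. Let $c_i\in\mathbb R^3$ be the unit vector pointing from $V_i$ to $V_{i+1}$, and write $x\cdot y$ for the complex bilinear product on $\mathbb C^3$. A generalized Kokotsakis belt over $\mathbb C$ around $p$ is given by the directions $a_i,b_i\in\mathbb C^3$, $a_i\cdot a_i=b_i\cdot b_i=1$, of two outer edges at each $V_i$, where $a_i$ bounds the (possibly skew) face along $V_{i-1}V_i$ and $b_i$ bounds the (possibly skew) face along $V_iV_{i+1}$; the lengths of the outer edges play no role. The four angles at $V_i$ have the cosines $$\cos\lambda_i=-c_{i-1}\cdot c_i,\quad \cos\gamma_i=-c_{i-1}\cdot a_i,\quad \cos\mu_i=a_i\cdot b_i,\quad \cos\delta_i=b_i\cdot c_i,$$ and the last three are required to be different from $\pm1$. The belt is of the isogonal type if for every $i$ either $\cos\lambda_i=\cos\mu_i$ and $\cos\delta_i=\cos\gamma_i$ (opposite angles are equal), or $\cos\lambda_i=-\cos\mu_i$ and $\cos\delta_i=-\cos\gamma_i$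 (opposite angles are supplementary); it is nondegenerate if $\cos\delta_i\ne\pm\cos\lambda_i$ for all $i$. The shape of a belt is the vector in $\mathbb C^{5n}$ of the numbers $\cos\gamma_i$, $\cos\delta_i$, $\cos\mu_i$, $b_i\cdot a_{i+1}$, $\det(c_i,b_i,a_{i+1})$, $i=0,\dots,n-1$, which describe the faces as rigid bodies. A belt is continuously flexible if there is a continuous path of belts around the fixed polygon $p$, parametrized by $[0,1]$, that starts at the given belt, keeps the shape constant, and never returns to the given belt. Then the set of shapes of the continuously flexible nondegenerate belts of the isogonal type around $p$ has complex dimension at least $2n-3$: it contains the image of a nonempty open subset of $\mathbb C^{2n-3}$ under an injective holomorphic immersion into $\mathbb C^{5n}$. -/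

import Mathlib

open scoped Matrix

noncomputable section

namespace Kokotsakis

/-- The unit vector pointing from `V i` to `V (i + 1)` (indices modulo `n`), as a vector of `ℂ³`. -/
def edgeDir {n : ℕ} [NeZero n] (V : Fin n → EuclideanSpace ℝ (Fin 3)) (i : Fin n) : Fin 3 → ℂ :=
  fun k => ((‖V (i + 1) - V i‖⁻¹ * (V (i + 1) k - V i k) : ℝ) : ℂ)

/-- A generalized Kokotsakis belt over `ℂ` around the closed polygon `V`, given by the directions of
the two outer edges that emanate from each vertex `V i`: the edge `a i` bounds the face along
`V (i - 1) V i`, and the edge `b i` bounds the face along `V i V (i + 1)`. So the face along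
`V i V (i + 1)` contains this segment and the edges `b i`, `a (i + 1)`, and need not be planar, and
the corner face at `V i` is spanned by `a i` and `b i`. The product `⬝ᵥ` is the complex bilinear
extension of the real inner product. None of the face angles at `V i` is zero or straight. -/
@[ext]
structure Belt {n : ℕ} [NeZero n] (V : Fin n → EuclideanSpace ℝ (Fin 3)) where
  a : Fin n → Fin 3 → ℂ
  b : Fin n → Fin 3 → ℂ
  a_unit : ∀ i, a i ⬝ᵥ a i = 1
  b_unit : ∀ i, b i ⬝ᵥ b i = 1
  gamma_proper : ∀ i, (-edgeDir V (i - 1) ⬝ᵥ a i) ^ 2 ≠ 1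
  mu_proper : ∀ i, (a i ⬝ᵥ b i) ^ 2 ≠ 1
  delta_proper : ∀ i, (b i ⬝ᵥ edgeDir V i) ^ 2 ≠ 1

/-- Cosine of the angle `λ` of the polygon at `V i`, between the directions to `V (i - 1)` and
to `V (i + 1)`. -/
def cosLambda {n : ℕ} [NeZero n] (V : Fin n → EuclideanSpace ℝ (Fin 3)) (i : Fin n) : ℂ :=
  -edgeDir V (i - 1) ⬝ᵥ edgeDir V i

namespace Belt

variable {n : ℕ} [NeZero n] {V : Fin n → EuclideanSpace ℝ (Fin 3)}

/-- Cosine of the angle `γ` at `V i` between the direction to `V (i - 1)` and `a i`. -/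
def cosGamma (β : Belt V) (i : Fin n) : ℂ := -edgeDir V (i - 1) ⬝ᵥ β.a i

/-- Cosine of the angle `μ` at `V i` between `a i` and `b i`. -/
def cosMu (β : Belt V) (i : Fin n) : ℂ := β.a i ⬝ᵥ β.b i

/-- Cosine of the angle `δ` at `V i` between `b i` and the direction to `V (i + 1)`. -/
def cosDelta (β : Belt V) (i : Fin n) : ℂ := β.b i ⬝ᵥ edgeDir V i

/-- Isogonal type: at every vertex both pairs of opposite angles are equal, or both are
supplementary. -/
def IsIsogonal (β : Belt V) : Prop :=
  ∀ i, (cosLambda V i = β.cosMu i ∧ β.cosDelta i = β.cosGamma i) ∨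
    (cosLambda V i = -β.cosMu i ∧ β.cosDelta i = -β.cosGamma i)

/-- The degenerate spherical isograms, those in which adjacent angles are equal or supplementary,
are excluded. -/
def IsNondegenerate (β : Belt V) : Prop :=
  ∀ i, β.cosDelta i ^ 2 ≠ cosLambda V i ^ 2

/-- The intrinsic shape of a belt: for each `i` the cosines of the three face angles at `V i`
other than the polygon's own, and the two numbers that, together with the face angles, fix the face
along `V i V (i + 1)` up to a rotation: the product of its outer edges `b i` and `a (i + 1)`, and the
oriented volume that they span with the direction of `V i V (i + 1)`. -/
def shape (β : Belt V) : Fin n → Fin 5 → ℂ :=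
  fun i => ![β.cosGamma i, β.cosDelta i, β.cosMu i, β.b i ⬝ᵥ β.a (i + 1),
    Matrix.det (Matrix.of ![edgeDir V i, β.b i, β.a (i + 1)])]

/-- Continuous flexibility: with the polygon held fixed, the belt can be moved continuously away
from its position while all of its faces stay rigid. -/
def IsFlexible (β : Belt V) : Prop :=
  ∃ γ : unitInterval → Belt V,
    Continuous (fun t => (γ t).a) ∧ Continuous (fun t => (γ t).b) ∧
    γ 0 = β ∧ (∀ t, (γ t).shape = β.shape) ∧ ∀ t, t ≠ 0 → γ t ≠ β

end Belt

/-- The set `S` has complex dimension at least `d`: it contains the image of a nonempty open subset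
of `ℂ^d` under an injective holomorphic immersion. -/
def HasComplexDimAtLeast {E : Type*} [NormedAddCommGroup E] [NormedSpace ℂ E]
    (d : ℕ) (S : Set E) : Prop :=
  ∃ (U : Set (Fin d → ℂ)) (φ : (Fin d → ℂ) → E),
    IsOpen U ∧ U.Nonempty ∧ DifferentiableOn ℂ φ U ∧ Set.InjOn φ U ∧
    (∀ u ∈ U, Function.Injective (fderiv ℂ φ u)) ∧ Set.MapsTo φ U S

end Kokotsakis

end

open scoped Matrix

noncomputable section

namespace Kokotsakis

/-! Over `ℂ`, the unit vectors at a given angle to an edge direction `c` form a conic, parametrized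
by `y ∈ ℂ*` through the isotropic eigenvectors of `c × ·`. The angle enters through `m`, the squared
tangent of its half. Rotation about `c` multiplies `y` by a scalar, so two outer edges along the
same polygon edge stay rigidly connected exactly when the ratio of their coordinates is constant.

It suffices to use corners whose opposite angles are equal. Let `T` be the tangent of half the
polygon's angle, and let `y`, `z` be the coordinates of the two outer edges. The condition on the
fourth angle is biquadratic in `y`, `z`, but for an isogram it splits into two bilinear factors
(`circleVec_in_dot_circleVec_out`). One of them is the Möbius relation `z = (T y + m) / (y + T)`.
The face along the next edge then gives `y' = s z` with `s` constant. Going once around the polygon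
composes `n` Möbius maps, and if the product is the identity, every generic starting value closes
up, which is a flexion (`exists_path_of_chain_eq_smul_one`).

The `2n` numbers `m`, `s` are thus subject to the three equations that make an element of `PGL₂(ℂ)`
trivial. These are solved explicitly for the last `m` and the last two `s` (`exists_eq_smul_one`),
which leaves `2n - 3` free parameters. Nondegeneracy is an open condition, satisfied by suitable
positive parameters (`exists_isGeneric`). The free parameters are rational functions of the shape,
so the map from parameters to shapes has a holomorphic left inverse and is an injective immersion
(`hasComplexDimAtLeast_of_leftInverse`). -/

/-- A vector `c` of unit length together with isotropic eigenvectors of the map `c × ·`. -/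
structure IsFrame (c e f : Fin 3 → ℂ) : Prop where
  cc : c ⬝ᵥ c = 1
  ce : c ⬝ᵥ e = 0
  cf : c ⬝ᵥ f = 0
  ee : e ⬝ᵥ e = 0
  ff : f ⬝ᵥ f = 0
  ef : e ⬝ᵥ f = 2
  cross_e : c ⨯₃ e = -Complex.I • e
  cross_f : c ⨯₃ f = Complex.I • f

/-! ### Cross product identities and uniqueness of isotropic frames -/

theorem cross_cross_eq (a b c : Fin 3 → ℂ) :
    a ⨯₃ (b ⨯₃ c) = (a ⬝ᵥ c) • b - (a ⬝ᵥ b) • c := by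
  ext i
  fin_cases i <;> simp [cross_apply, dotProduct, Fin.sum_univ_three] <;> ring

theorem dot_cross_swap (a b c : Fin 3 → ℂ) : a ⬝ᵥ (b ⨯₃ c) = -((b ⨯₃ a) ⬝ᵥ c) := by
  simp [cross_apply, dotProduct, Fin.sum_univ_three]; ring

theorem det_eq_neg_dot_cross (c b a : Fin 3 → ℂ) :
    Matrix.det (Matrix.of ![c, b, a]) = -(b ⬝ᵥ (c ⨯₃ a)) := by
  simp [Matrix.det_fin_three, cross_apply, dotProduct, Fin.sum_univ_three]; ring

/-- Since `c × ·` is skew for the bilinear product, `r (v ⬝ᵥ w) = -r (v ⬝ᵥ w)`. -/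
theorem dot_eq_zero_of_cross_eq {c v w : Fin 3 → ℂ} {r : ℂ} (hr : r ≠ 0)
    (hv : c ⨯₃ v = r • v) (hw : c ⨯₃ w = r • w) : v ⬝ᵥ w = 0 := by
  have h := dot_cross_swap v c w
  rw [hv, hw, dotProduct_smul, smul_dotProduct, smul_eq_mul] at h
  have : 2 * r * (v ⬝ᵥ w) = 0 := by linear_combination h
  simpa [hr] using this

/-- The eigenspaces of `c × ·` for the eigenvalues `±i` are lines. -/
theorem eq_smul_of_cross_eq {c e f v : Fin 3 → ℂ} {r : ℂ} (hr : r ≠ 0)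
    (he : c ⨯₃ e = r • e) (hce : c ⬝ᵥ e = 0) (hef : e ⬝ᵥ f = 2)
    (hv : c ⨯₃ v = r • v) : v = ((v ⬝ᵥ f) / 2) • e := by
  -- Expanding `e × (c × v) = r (e × v)`, both terms vanish, so `v` is parallel to `e`; crossing
  -- with `f` then gives the factor.
  have h0 : e ⨯₃ v = 0 := by
    have h := cross_cross_eq e c v
    rw [hv, dot_eq_zero_of_cross_eq hr he hv, dotProduct_comm e c, hce, map_smul] at h
    simpa [hr] using h
  have h := cross_cross_eq f e v
  rw [h0, dotProduct_comm f e, hef, dotProduct_comm f v] at h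
  have h2 : (2 : ℂ) • v = (v ⬝ᵥ f) • e := by
    rw [map_zero] at h
    exact (sub_eq_zero.1 h.symm).symm
  rw [div_eq_inv_mul, mul_smul, ← h2, smul_smul]
  norm_num

theorem IsFrame.exists_smul {c e f e' f' : Fin 3 → ℂ} (h : IsFrame c e f)
    (h' : IsFrame c e' f') : ∃ r : ℂ, r ≠ 0 ∧ e' = r • e ∧ f' = r⁻¹ • f := by
  have h1 := eq_smul_of_cross_eq (neg_ne_zero.2 Complex.I_ne_zero) h.cross_e h.ce h.ef h'.cross_e
  have h2 := eq_smul_of_cross_eq Complex.I_ne_zero h.cross_f h.cf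
    (by rw [dotProduct_comm]; exact h.ef) h'.cross_f
  set r := (e' ⬝ᵥ f) / 2
  set q := (f' ⬝ᵥ e) / 2
  have h3 : r * q = 1 := by
    have := h'.ef
    rw [h1, h2, smul_dotProduct, dotProduct_smul, h.ef] at this
    simp only [smul_eq_mul] at this
    linear_combination this / 2
  have hr : r ≠ 0 := left_ne_zero_of_mul_eq_one h3
  refine ⟨r, hr, h1, ?_⟩
  rwa [← eq_inv_of_mul_eq_one_right h3]

/-! ### Circle coordinates of unit vectors around an axis -/

/-- The unit vector whose angle with `c` has the half-tangent square `m`, and whose position on the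
corresponding circle is `y`. -/
def circleVec (c e f : Fin 3 → ℂ) (m y : ℂ) : Fin 3 → ℂ :=
  (1 + m)⁻¹ • ((1 - m) • c + y • e + (m / y) • f)

section Frame
variable {c e f : Fin 3 → ℂ}

theorem IsFrame.dot_circleVec (h : IsFrame c e f) (m y : ℂ) :
    c ⬝ᵥ circleVec c e f m y = (1 - m) / (1 + m) := by
  simp only [circleVec, dotProduct_smul, dotProduct_add, h.cc, h.ce, h.cf, smul_eq_mul]
  ring

theorem IsFrame.circleVec_dot_circleVec (h : IsFrame c e f) (m y m' y' : ℂ) :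
    circleVec c e f m y ⬝ᵥ circleVec c e f m' y' =
      ((1 - m) * (1 - m') + 2 * (y * (m' / y') + (m / y) * y')) / ((1 + m) * (1 + m')) := by
  simp only [circleVec, dotProduct_smul, smul_dotProduct, add_dotProduct, dotProduct_add, h.cc, h.ce,
    h.cf, h.ee, h.ff, h.ef, dotProduct_comm e c, dotProduct_comm f c, dotProduct_comm f e,
    smul_eq_mul, div_eq_mul_inv, mul_inv]
  ring

theorem IsFrame.circleVec_unit (h : IsFrame c e f) {m y : ℂ} (hm : 1 + m ≠ 0) (hy : y ≠ 0) :
    circleVec c e f m y ⬝ᵥ circleVec c e f m y = 1 := by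
  rw [h.circleVec_dot_circleVec]
  field_simp
  ring

theorem IsFrame.det_circleVec (h : IsFrame c e f) (m y m' y' : ℂ) :
    Matrix.det (Matrix.of ![c, circleVec c e f m y, circleVec c e f m' y']) =
      2 * Complex.I * ((m / y) * y' - y * (m' / y')) / ((1 + m) * (1 + m')) := by
  rw [det_eq_neg_dot_cross]
  simp only [circleVec, map_smul, map_add, cross_self, h.cross_e, h.cross_f, dotProduct_smul,
    smul_dotProduct, add_dotProduct, dotProduct_add, dotProduct_zero, h.ce, h.cf, h.ee, h.ff, h.ef,
    dotProduct_comm f e, smul_eq_mul, div_eq_mul_inv, mul_inv]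
  ring

theorem IsFrame.circleVec_dot_f (h : IsFrame c e f) (m y : ℂ) :
    circleVec c e f m y ⬝ᵥ f = (1 + m)⁻¹ * (2 * y) := by
  simp only [circleVec, smul_dotProduct, add_dotProduct, h.cf, h.ef, h.ff, smul_eq_mul]
  ring

theorem circleVec_smul (r m y : ℂ) :
    circleVec c (r • e) (r⁻¹ • f) m y = circleVec c e f m (r * y) := by
  simp only [circleVec, smul_smul]
  rw [mul_comm y r, show m / y * r⁻¹ = m / (r * y) by rw [mul_comm r y, div_mul_eq_div_div, div_eq_mul_inv (m / y)]]

end Frame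

/-! ### Frames adapted to a corner, and the isogram relation -/

/-- For unit vectors `c`, `c'` with `c ⬝ᵥ c' = C` and `S ^ 2 = 1 - C ^ 2`, the vector of the
plane of `c`, `c'` orthogonal to `c`, plus `j` times the normal of the plane. -/
def inVec (c c' : Fin 3 → ℂ) (C S j : ℂ) : Fin 3 → ℂ :=
  S⁻¹ • (c' - C • c + j • (c ⨯₃ c'))

/-- As `inVec`, with the vector of the plane of `c`, `c'` orthogonal to `c'`. -/
def outVec (c c' : Fin 3 → ℂ) (C S j : ℂ) : Fin 3 → ℂ :=
  S⁻¹ • (C • c' - c + j • (c ⨯₃ c'))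

section Corner
variable {c c' : Fin 3 → ℂ} {C S : ℂ}

theorem cross_dot_cross_self (hc : c ⬝ᵥ c = 1) (hc' : c' ⬝ᵥ c' = 1) (hC : c ⬝ᵥ c' = C)
    (hS : S ^ 2 = 1 - C ^ 2) : (c ⨯₃ c') ⬝ᵥ (c ⨯₃ c') = S ^ 2 := by
  rw [cross_dot_cross, hc, hc', hC, dotProduct_comm c' c, hC, hS]; ring

theorem inVec_isFrame (hc : c ⬝ᵥ c = 1) (hc' : c' ⬝ᵥ c' = 1) (hC : c ⬝ᵥ c' = C)
    (hS : S ^ 2 = 1 - C ^ 2) (hS0 : S ≠ 0) :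
    IsFrame c (inVec c c' C S Complex.I) (inVec c c' C S (-Complex.I)) := by
  have hn := cross_dot_cross_self hc hc' hC hS
  have hC' : c' ⬝ᵥ c = C := by rw [dotProduct_comm, hC]
  have h1 : c ⬝ᵥ (c ⨯₃ c') = 0 := dot_self_cross c c'
  have h2 : c' ⬝ᵥ (c ⨯₃ c') = 0 := dot_cross_self c c'
  have h3 : (c ⨯₃ c') ⬝ᵥ c = 0 := by rw [dotProduct_comm, h1]
  have h4 : (c ⨯₃ c') ⬝ᵥ c' = 0 := by rw [dotProduct_comm, h2]
  have hI := Complex.I_sq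
  have key : ∀ j k : ℂ, inVec c c' C S j ⬝ᵥ inVec c c' C S k = 1 + j * k := by
    intro j k
    simp only [inVec, dotProduct_smul, smul_dotProduct, add_dotProduct, dotProduct_add,
      sub_dotProduct, dotProduct_sub, hc, hc', hC, hC', h1, h2, h3, h4, hn, smul_eq_mul]
    field_simp
    linear_combination -hS
  have key2 : ∀ j : ℂ, c ⬝ᵥ inVec c c' C S j = 0 := by
    intro j
    simp only [inVec, dotProduct_smul, dotProduct_add, dotProduct_sub, hc, hC, h1, smul_eq_mul]
    ring
  have key3 : ∀ j : ℂ, j ^ 2 = -1 → c ⨯₃ inVec c c' C S j = -j • inVec c c' C S j := by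
    intro j hj
    simp only [inVec, map_smul, map_add, map_sub, cross_self, cross_cross_eq, hc, hC]
    rw [smul_comm]
    congr 1
    ext i
    simp only [Pi.add_apply, Pi.sub_apply, Pi.smul_apply, smul_eq_mul, Pi.zero_apply]
    linear_combination ((c ⨯₃ c') i) * hj
  refine ⟨hc, key2 _, key2 _, ?_, ?_, ?_, key3 _ hI, ?_⟩
  · rw [key]; linear_combination hI
  · rw [key]; linear_combination hI
  · rw [key]; linear_combination -hI
  · rw [key3 _ (by rw [neg_sq, hI]), neg_neg]

theorem outVec_isFrame (hc : c ⬝ᵥ c = 1) (hc' : c' ⬝ᵥ c' = 1) (hC : c ⬝ᵥ c' = C)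
    (hS : S ^ 2 = 1 - C ^ 2) (hS0 : S ≠ 0) :
    IsFrame c' (outVec c c' C S Complex.I) (outVec c c' C S (-Complex.I)) := by
  have hn := cross_dot_cross_self hc hc' hC hS
  have hC' : c' ⬝ᵥ c = C := by rw [dotProduct_comm, hC]
  have h1 : c ⬝ᵥ (c ⨯₃ c') = 0 := dot_self_cross c c'
  have h2 : c' ⬝ᵥ (c ⨯₃ c') = 0 := dot_cross_self c c'
  have h3 : (c ⨯₃ c') ⬝ᵥ c = 0 := by rw [dotProduct_comm, h1]
  have h4 : (c ⨯₃ c') ⬝ᵥ c' = 0 := by rw [dotProduct_comm, h2]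
  have h5 : c' ⨯₃ c = -(c ⨯₃ c') := (cross_anticomm c c').symm
  have hI := Complex.I_sq
  have key : ∀ j k : ℂ, outVec c c' C S j ⬝ᵥ outVec c c' C S k = 1 + j * k := by
    intro j k
    simp only [outVec, dotProduct_smul, smul_dotProduct, add_dotProduct, dotProduct_add,
      sub_dotProduct, dotProduct_sub, hc, hc', hC, hC', h1, h2, h3, h4, hn, smul_eq_mul]
    field_simp
    linear_combination -hS
  have key2 : ∀ j : ℂ, c' ⬝ᵥ outVec c c' C S j = 0 := by
    intro j
    simp only [outVec, dotProduct_smul, dotProduct_add, dotProduct_sub, hc', hC', h2, smul_eq_mul]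
    ring
  have key3 : ∀ j : ℂ, j ^ 2 = -1 → c' ⨯₃ outVec c c' C S j = -j • outVec c c' C S j := by
    intro j hj
    simp only [outVec, map_smul, map_add, map_sub, cross_self, cross_cross_eq, hc', hC', h5]
    rw [smul_comm]
    congr 1
    ext i
    simp only [Pi.add_apply, Pi.sub_apply, Pi.smul_apply, smul_eq_mul, Pi.zero_apply, Pi.neg_apply]
    linear_combination ((c ⨯₃ c') i) * hj
  refine ⟨hc', key2 _, key2 _, ?_, ?_, ?_, key3 _ hI, ?_⟩
  · rw [key]; linear_combination hI
  · rw [key]; linear_combination hI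
  · rw [key]; linear_combination -hI
  · rw [key3 _ (by rw [neg_sq, hI]), neg_neg]

/-- The bilinear relation between the positions of the two outer edges that makes the fourth angle of
the corner opposite and equal to the angle between `-c` and `c'`. -/
theorem circleVec_in_dot_circleVec_out (hc : c ⬝ᵥ c = 1) (hc' : c' ⬝ᵥ c' = 1) (hC : c ⬝ᵥ c' = C)
    (hS : S ^ 2 = 1 - C ^ 2) (hS0 : S ≠ 0) {m y z : ℂ} (hm : 1 + m ≠ 0) (hy : y ≠ 0) (hz : z ≠ 0)
    (hyz : z * (y + (1 + C) / S) = (1 + C) / S * y + m) :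
    circleVec c (inVec c c' C S Complex.I) (inVec c c' C S (-Complex.I)) m y ⬝ᵥ
      circleVec c' (outVec c c' C S Complex.I) (outVec c c' C S (-Complex.I)) m z = C := by
  have hn := cross_dot_cross_self hc hc' hC hS
  have hC' : c' ⬝ᵥ c = C := by rw [dotProduct_comm, hC]
  have h1 : c ⬝ᵥ (c ⨯₃ c') = 0 := dot_self_cross c c'
  have h2 : c' ⬝ᵥ (c ⨯₃ c') = 0 := dot_cross_self c c'
  have h3 : (c ⨯₃ c') ⬝ᵥ c = 0 := by rw [dotProduct_comm, h1]
  have h4 : (c ⨯₃ c') ⬝ᵥ c' = 0 := by rw [dotProduct_comm, h2]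
  have k1 : ∀ j k : ℂ, inVec c c' C S j ⬝ᵥ outVec c c' C S k = C + j * k := by
    intro j k
    simp only [inVec, outVec, dotProduct_smul, smul_dotProduct, add_dotProduct, dotProduct_add,
      sub_dotProduct, dotProduct_sub, hc, hc', hC, hC', h1, h2, h3, h4, hn, smul_eq_mul]
    field_simp
    linear_combination -C * hS
  have k2 : ∀ j : ℂ, c ⬝ᵥ outVec c c' C S j = -S := by
    intro j
    simp only [outVec, dotProduct_smul, dotProduct_add, dotProduct_sub, hc, hC, h1, smul_eq_mul]
    field_simp
    linear_combination hS
  have k3 : ∀ j : ℂ, inVec c c' C S j ⬝ᵥ c' = S := by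
    intro j
    simp only [inVec, smul_dotProduct, add_dotProduct, sub_dotProduct, hc', hC, h4, smul_eq_mul]
    field_simp
    linear_combination -hS
  simp only [circleVec, dotProduct_smul, smul_dotProduct, add_dotProduct, dotProduct_add, hC, k1, k2,
    k3, smul_eq_mul, mul_neg, neg_mul, neg_neg, Complex.I_mul_I]
  field_simp at hyz ⊢
  -- With `X = z y - m` and `Y = z - y`, the condition is `(C - 1) X² + (C + 1) m Y² - S (1 - m) X Y
  -- = 0`. After multiplication by `S` it factors as `(S X + (1 + C) Y) ((C - 1) X + m S Y)`, and
  -- `hyz` is the vanishing of the first factor.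
  refine mul_left_cancel₀ hS0 ?_
  linear_combination ((C - 1) * (z * y - m) + m * S * (z - y)) * hyz -
    (z * y - m) * (z - y) * hS

end Corner

/-! ### Angles of the polygon, and belts in circle coordinates -/

section Polygon
variable {n : ℕ} [NeZero n] {V : Fin n → EuclideanSpace ℝ (Fin 3)}

theorem edgeDir_dot_edgeDir (i j : Fin n) :
    edgeDir V i ⬝ᵥ edgeDir V j =
      ((inner ℝ (V (i + 1) - V i) (V (j + 1) - V j) /
        (‖V (i + 1) - V i‖ * ‖V (j + 1) - V j‖) : ℝ) : ℂ) := by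
  simp only [edgeDir, dotProduct, Fin.sum_univ_three, PiLp.inner_apply, PiLp.sub_apply,
    RCLike.inner_apply, conj_trivial]
  push_cast
  rw [div_eq_mul_inv, mul_inv]
  ring

theorem edge_ne_zero_and_not_parallel
    (hV : ∀ i, AffineIndependent ℝ ![V (i - 1), V i, V (i + 1)]) (i : Fin n) :
    V i - V (i - 1) ≠ 0 ∧ V (i + 1) - V i ≠ 0 ∧
      ∀ r : ℝ, V (i + 1) - V i ≠ r • (V i - V (i - 1)) := by
  have hinj := (hV i).injective
  have h10 : V i ≠ V (i - 1) := fun h => by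
    have := @hinj 1 0 (by simpa using h)
    simp at this
  have h21 : V (i + 1) ≠ V i := fun h => by
    have := @hinj 2 1 (by simpa using h)
    simp at this
  refine ⟨sub_ne_zero.2 h10, sub_ne_zero.2 h21, fun r hr => ?_⟩
  have h := affineIndependent_iff_not_collinear_set.1 (hV i)
  refine h ((collinear_iff_of_mem (p₀ := V i) (by simp)).2 ⟨V i - V (i - 1), ?_⟩)
  intro p hp
  simp only [Set.mem_insert_iff, Set.mem_singleton_iff] at hp
  rcases hp with rfl | rfl | rfl
  · exact ⟨-1, by simp⟩
  · exact ⟨0, by simp⟩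
  · exact ⟨r, by rw [← hr]; simp⟩

variable (V) in
/-- Cosines and sines of the exterior angles of a polygon without straight or zero angles. -/
structure ExteriorAngles where
  C : Fin n → ℝ
  S : Fin n → ℝ
  unit : ∀ i, edgeDir V i ⬝ᵥ edgeDir V i = 1
  dot : ∀ i, edgeDir V (i - 1) ⬝ᵥ edgeDir V i = (C i : ℂ)
  sq : ∀ i, S i ^ 2 = 1 - C i ^ 2
  S_pos : ∀ i, 0 < S i

theorem nonempty_exteriorAngles
    (hV : ∀ i, AffineIndependent ℝ ![V (i - 1), V i, V (i + 1)]) :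
    Nonempty (ExteriorAngles V) := by
  have hdot : ∀ i, ∃ C : ℝ, edgeDir V (i - 1) ⬝ᵥ edgeDir V i = (C : ℂ) ∧ C ^ 2 < 1 := by
    intro i
    obtain ⟨h1, h2, h3⟩ := edge_ne_zero_and_not_parallel hV i
    refine ⟨_, edgeDir_dot_edgeDir _ _, ?_⟩
    rw [sq_lt_one_iff_abs_lt_one, sub_add_cancel]
    -- Equality in the Cauchy–Schwarz inequality would make consecutive edges parallel.
    refine lt_of_le_of_ne (abs_real_inner_div_norm_mul_norm_le_one _ _) fun h => ?_
    obtain ⟨-, r, -, hr⟩ := (abs_real_inner_div_norm_mul_norm_eq_one_iff _ _).1 h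
    exact h3 r hr
  choose C hC hC1 using hdot
  refine ⟨⟨C, fun i => √(1 - C i ^ 2), fun i => ?_, hC, fun i => ?_, fun i => ?_⟩⟩
  · have h2 := norm_ne_zero_iff.2 (edge_ne_zero_and_not_parallel hV i).2.1
    rw [edgeDir_dot_edgeDir, real_inner_self_eq_norm_sq, ← sq, div_self (pow_ne_zero 2 h2),
      Complex.ofReal_one]
  · exact Real.sq_sqrt (by linarith [hC1 i])
  · exact Real.sqrt_pos.2 (by linarith [hC1 i])

namespace ExteriorAngles
variable (D : ExteriorAngles V)

/-- The tangent of half the angle of the polygon. -/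
def T (i : Fin n) : ℝ := (1 + D.C i) / D.S i

theorem abs_C_lt_one (i : Fin n) : -1 < D.C i ∧ D.C i < 1 := by
  have h : D.C i ^ 2 < 1 := by nlinarith [D.sq i, D.S_pos i]
  exact abs_lt.1 (sq_lt_one_iff_abs_lt_one _ |>.1 h)

theorem T_pos (i : Fin n) : 0 < D.T i :=
  div_pos (by linarith [D.abs_C_lt_one i]) (D.S_pos i)

theorem T_sq_mul (i : Fin n) : D.T i ^ 2 * (1 - D.C i) = 1 + D.C i := by
  have h := D.S_pos i
  rw [T]
  field_simp
  rw [D.sq]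
  ring

theorem sq_complex (i : Fin n) : (D.S i : ℂ) ^ 2 = 1 - (D.C i : ℂ) ^ 2 := by
  exact_mod_cast congrArg (fun x : ℝ => (x : ℂ)) (D.sq i)

theorem S_ne_zero (i : Fin n) : (D.S i : ℂ) ≠ 0 :=
  Complex.ofReal_ne_zero.2 (D.S_pos i).ne'

/-- For `j = ±i`, the isotropic vectors of the frame of the edge that enters the vertex `i`. -/
def eIn (i : Fin n) (j : ℂ) : Fin 3 → ℂ :=
  inVec (edgeDir V (i - 1)) (edgeDir V i) (D.C i) (D.S i) j

/-- For `j = ±i`, the isotropic vectors of the frame of the edge that leaves the vertex `i`. -/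
def eOut (i : Fin n) (j : ℂ) : Fin 3 → ℂ :=
  outVec (edgeDir V (i - 1)) (edgeDir V i) (D.C i) (D.S i) j

theorem isFrame_in (i : Fin n) :
    IsFrame (edgeDir V (i - 1)) (D.eIn i Complex.I) (D.eIn i (-Complex.I)) :=
  inVec_isFrame (D.unit _) (D.unit _) (D.dot i) (D.sq_complex i) (D.S_ne_zero i)

theorem isFrame_out (i : Fin n) :
    IsFrame (edgeDir V i) (D.eOut i Complex.I) (D.eOut i (-Complex.I)) :=
  outVec_isFrame (D.unit _) (D.unit _) (D.dot i) (D.sq_complex i) (D.S_ne_zero i)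

/-- The edge that leaves the vertex `i` is the one that enters the vertex `i + 1`, so both frames
have the same axis. -/
theorem exists_twist (i : Fin n) : ∃ r : ℂ, r ≠ 0 ∧
    D.eIn (i + 1) Complex.I = r • D.eOut i Complex.I ∧
    D.eIn (i + 1) (-Complex.I) = r⁻¹ • D.eOut i (-Complex.I) := by
  have h := D.isFrame_in (i + 1)
  rw [add_sub_cancel_right] at h
  exact (D.isFrame_out i).exists_smul h

/-- The rotation about the edge `i` between the planes of the corners at its two ends. -/
def twist (i : Fin n) : ℂ := (D.exists_twist i).choose

theorem twist_ne_zero (i : Fin n) : D.twist i ≠ 0 := (D.exists_twist i).choose_spec.1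

/-- The outer edges `a` with half-tangent squares `m` and circle coordinates `y`. -/
def outerA (m y : Fin n → ℂ) (i : Fin n) : Fin 3 → ℂ :=
  -circleVec (edgeDir V (i - 1)) (D.eIn i Complex.I) (D.eIn i (-Complex.I)) (m i) (y i)

/-- The outer edges `b` with half-tangent squares `m` and circle coordinates `z`. -/
def outerB (m z : Fin n → ℂ) (i : Fin n) : Fin 3 → ℂ :=
  circleVec (edgeDir V i) (D.eOut i Complex.I) (D.eOut i (-Complex.I)) (m i) (z i)

theorem outerA_add_one (m y : Fin n → ℂ) (i : Fin n) :
    D.outerA m y (i + 1) = -circleVec (edgeDir V i) (D.eOut i Complex.I) (D.eOut i (-Complex.I))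
      (m (i + 1)) (D.twist i * y (i + 1)) := by
  obtain ⟨h1, h2⟩ : D.eIn (i + 1) Complex.I = D.twist i • D.eOut i Complex.I ∧
      D.eIn (i + 1) (-Complex.I) = (D.twist i)⁻¹ • D.eOut i (-Complex.I) :=
    (D.exists_twist i).choose_spec.2
  rw [outerA, add_sub_cancel_right, h1, h2, circleVec_smul]

/-- The conditions under which `m`, `y`, `z` are the coordinates of the outer edges of a belt all of
whose corners have equal opposite angles. -/
structure IsCoord (m y z : Fin n → ℂ) : Prop where
  m_ne : ∀ i, m i ≠ 0
  m_ne' : ∀ i, 1 + m i ≠ 0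
  y_ne : ∀ i, y i ≠ 0
  z_ne : ∀ i, z i ≠ 0
  rel : ∀ i, z i * (y i + D.T i) = D.T i * y i + m i

variable {D} {m y z : Fin n → ℂ}

theorem sq_cos_ne_one {m : ℂ} (hm : m ≠ 0) (hm' : 1 + m ≠ 0) :
    ((1 - m) / (1 + m)) ^ 2 ≠ 1 := by
  rw [div_pow, Ne, div_eq_one_iff_eq (pow_ne_zero 2 hm')]
  intro h
  apply hm
  linear_combination -h / 4

theorem neg_edgeDir_dot_outerA (D : ExteriorAngles V) (m y : Fin n → ℂ) (i : Fin n) :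
    -edgeDir V (i - 1) ⬝ᵥ D.outerA m y i = (1 - m i) / (1 + m i) := by
  rw [outerA, neg_dotProduct_neg, (D.isFrame_in i).dot_circleVec]

theorem outerB_dot_edgeDir (D : ExteriorAngles V) (m z : Fin n → ℂ) (i : Fin n) :
    D.outerB m z i ⬝ᵥ edgeDir V i = (1 - m i) / (1 + m i) := by
  rw [dotProduct_comm, outerB, (D.isFrame_out i).dot_circleVec]

theorem IsCoord.outerA_dot_outerB (h : D.IsCoord m y z) (i : Fin n) :
    D.outerA m y i ⬝ᵥ D.outerB m z i = -(D.C i : ℂ) := by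
  rw [outerA, outerB, neg_dotProduct]
  congr 1
  refine circleVec_in_dot_circleVec_out (D.unit _) (D.unit _) (D.dot i) (D.sq_complex i)
    (D.S_ne_zero i) (h.m_ne' i) (h.y_ne i) (h.z_ne i) ?_
  have := h.rel i
  rw [T] at this
  push_cast at this
  exact this

theorem cosLambda_eq (D : ExteriorAngles V) (i : Fin n) : cosLambda V i = -(D.C i : ℂ) := by
  rw [cosLambda, neg_dotProduct, D.dot]

/-- The belt with given coordinates of its outer edges. -/
def IsCoord.belt (h : D.IsCoord m y z) : Belt V where
  a := D.outerA m y
  b := D.outerB m z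
  a_unit i := by
    rw [outerA, neg_dotProduct_neg, (D.isFrame_in i).circleVec_unit (h.m_ne' i) (h.y_ne i)]
  b_unit i := (D.isFrame_out i).circleVec_unit (h.m_ne' i) (h.z_ne i)
  gamma_proper i := by
    rw [neg_edgeDir_dot_outerA]
    exact sq_cos_ne_one (h.m_ne i) (h.m_ne' i)
  -- The angle `μ` equals the polygon's angle, which is neither zero nor straight.
  mu_proper i := by
    rw [h.outerA_dot_outerB, neg_sq]
    intro h1
    have h2 := D.sq_complex i
    rw [h1, sub_self] at h2
    exact D.S_ne_zero i (pow_eq_zero_iff two_ne_zero |>.1 h2)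
  delta_proper i := by
    rw [outerB_dot_edgeDir]
    exact sq_cos_ne_one (h.m_ne i) (h.m_ne' i)

theorem IsCoord.isIsogonal (h : D.IsCoord m y z) : h.belt.IsIsogonal := by
  intro i
  refine Or.inl ⟨?_, ?_⟩
  · rw [cosLambda_eq D]
    exact (h.outerA_dot_outerB i).symm
  · exact (outerB_dot_edgeDir D m z i).trans (neg_edgeDir_dot_outerA D m y i).symm

/-- As `cos λ = (1 - T²) / (1 + T²)` and `cos δ = (1 - m) / (1 + m)`, the two excluded cases are `m
= T²` and `m = 1 / T²`. -/
theorem IsCoord.isNondegenerate (h : D.IsCoord m y z) (h1 : ∀ i, (D.T i : ℂ) ^ 2 ≠ m i)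
    (h2 : ∀ i, (D.T i : ℂ) ^ 2 * m i ≠ 1) : h.belt.IsNondegenerate := by
  intro i hi
  have hx : h.belt.cosDelta i = (1 - m i) / (1 + m i) := outerB_dot_edgeDir D m z i
  rw [hx, cosLambda_eq D] at hi
  have hT : (D.T i : ℂ) ^ 2 * (1 - D.C i) = 1 + D.C i := by
    exact_mod_cast congrArg (fun x : ℝ => (x : ℂ)) (D.T_sq_mul i)
  have hC := D.abs_C_lt_one i
  have hC1 : (1 - (D.C i : ℂ)) ≠ 0 := by
    exact_mod_cast (show (1 - D.C i) ≠ 0 by linarith)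
  have hm := h.m_ne' i
  rcases sq_eq_sq_iff_eq_or_eq_neg.1 hi with h3 | h3
  · rw [div_eq_iff hm] at h3
    refine h1 i (mul_right_cancel₀ hC1 ?_)
    linear_combination hT + h3
  · rw [div_eq_iff hm] at h3
    refine h2 i (mul_right_cancel₀ hC1 ?_)
    linear_combination m i * hT - h3

variable (D) in
/-- The shape of the belts with angle coordinates `m` and dihedral angle coordinates `s`. -/
def shapeOf (m s : Fin n → ℂ) : Fin n → Fin 5 → ℂ := fun i =>
  ![(1 - m i) / (1 + m i), (1 - m i) / (1 + m i), -(D.C i : ℂ),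
    -(((1 - m i) * (1 - m (i + 1)) +
      2 * (m (i + 1) / (D.twist i * s i) + m i * (D.twist i * s i))) /
        ((1 + m i) * (1 + m (i + 1)))),
    -(2 * Complex.I * (m i * (D.twist i * s i) - m (i + 1) / (D.twist i * s i)) /
        ((1 + m i) * (1 + m (i + 1))))]

/-- In a common frame of the edge, the outer edges have coordinates `z i` and `twist i * y (i + 1)`.
Their product and volume depend only on the ratio of these, which is `twist i * s i`; hence the
shape is constant when `y`, `z` vary with `m`, `s` fixed. -/
theorem IsCoord.shape_eq (h : D.IsCoord m y z) {s : Fin n → ℂ} (hs : ∀ i, y (i + 1) = s i * z i) :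
    h.belt.shape = D.shapeOf m s := by
  have hb : ∀ i, h.belt.b i = circleVec (edgeDir V i) (D.eOut i Complex.I) (D.eOut i (-Complex.I))
    (m i) (z i) := fun i => rfl
  have ha : ∀ i, h.belt.a (i + 1) = -circleVec (edgeDir V i) (D.eOut i Complex.I)
      (D.eOut i (-Complex.I)) (m (i + 1)) (D.twist i * y (i + 1)) := D.outerA_add_one m y
  funext i
  have hz := h.z_ne i
  have e1 : z i * (m (i + 1) / (D.twist i * y (i + 1))) = m (i + 1) / (D.twist i * s i) := by
    rw [hs i, ← mul_assoc, ← div_div, mul_div_cancel₀ _ hz]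
  have e2 : m i / z i * (D.twist i * y (i + 1)) = m i * (D.twist i * s i) := by
    rw [hs i]
    field_simp
  have hg : h.belt.cosGamma i = (1 - m i) / (1 + m i) := neg_edgeDir_dot_outerA D m y i
  have hd : h.belt.cosDelta i = (1 - m i) / (1 + m i) := outerB_dot_edgeDir D m z i
  have hmu : h.belt.cosMu i = -(D.C i : ℂ) := h.outerA_dot_outerB i
  have h4 : h.belt.b i ⬝ᵥ h.belt.a (i + 1) = -(((1 - m i) * (1 - m (i + 1)) +
      2 * (m (i + 1) / (D.twist i * s i) + m i * (D.twist i * s i))) /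
        ((1 + m i) * (1 + m (i + 1)))) := by
    rw [hb, ha, dotProduct_neg, (D.isFrame_out i).circleVec_dot_circleVec, e1, e2]
  have h5 : Matrix.det (Matrix.of ![edgeDir V i, h.belt.b i, h.belt.a (i + 1)]) =
      -(2 * Complex.I * (m i * (D.twist i * s i) - m (i + 1) / (D.twist i * s i)) /
        ((1 + m i) * (1 + m (i + 1)))) := by
    rw [hb, ha, ← e1, ← e2, ← (D.isFrame_out i).det_circleVec]
    simp only [Matrix.det_fin_three, Matrix.of_apply, Matrix.cons_val', Matrix.cons_val_zero,
      Matrix.cons_val_one, Matrix.cons_val, Pi.neg_apply]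
    ring
  simp only [Belt.shape, shapeOf, hg, hd, hmu, h4, h5]

theorem IsCoord.coord_eq_of_belt_eq {y' z' : Fin n → ℂ} (h : D.IsCoord m y z)
    (h' : D.IsCoord m y' z') (he : h.belt = h'.belt) (i : Fin n) : y i = y' i := by
  have h1 : D.outerA m y i = D.outerA m y' i := congrFun (congrArg Belt.a he) i
  have h2 := congrArg (fun v => v ⬝ᵥ D.eIn i (-Complex.I)) (neg_injective h1)
  simp only [(D.isFrame_in i).circleVec_dot_f] at h2
  have h3 := mul_left_cancel₀ (inv_ne_zero (h.m_ne' i)) h2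
  exact mul_left_cancel₀ two_ne_zero h3

theorem continuous_circleVec {X : Type*} [TopologicalSpace X] (c e f : Fin 3 → ℂ) (m : ℂ)
    {y : X → ℂ} (hy : Continuous y) (hy0 : ∀ t, y t ≠ 0) :
    Continuous fun t => circleVec c e f m (y t) := by
  unfold circleVec
  have : Continuous fun t => m / y t := continuous_const.div hy hy0
  fun_prop

/-- A one-parameter family of coordinates with fixed `m` and `s` is a flexion. -/
theorem isFlexible_of_path {s : Fin n → ℂ} {y z : unitInterval → Fin n → ℂ}
    (h : ∀ t, D.IsCoord m (y t) (z t)) (hs : ∀ t i, y t (i + 1) = s i * z t i)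
    (hy : Continuous y) (hz : Continuous z) (i₀ : Fin n) (hinj : ∀ t, y t i₀ = y 0 i₀ → t = 0) :
    (h 0).belt.IsFlexible := by
  refine ⟨fun t => (h t).belt, ?_, ?_, rfl, fun t => ?_, fun t ht he => ht (hinj t ?_)⟩
  · refine continuous_pi fun i => (continuous_circleVec _ _ _ _ ?_ fun t => (h t).y_ne i).neg
    exact (continuous_apply i).comp hy
  · refine continuous_pi fun i => continuous_circleVec _ _ _ _ ?_ fun t => (h t).z_ne i
    exact (continuous_apply i).comp hz
  · rw [(h t).shape_eq (hs t), (h 0).shape_eq (hs 0)]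
  · exact (h t).coord_eq_of_belt_eq (h 0) he i₀

end ExteriorAngles
end Polygon

/-! ### A criterion for the dimension -/

/-- A family of maps with a differentiable left inverse bounds the dimension from below. -/
theorem hasComplexDimAtLeast_of_leftInverse {E X : Type*} [NormedAddCommGroup E] [NormedSpace ℂ E]
    [NormedAddCommGroup X] [NormedSpace ℂ X] [FiniteDimensional ℂ X] {d : ℕ}
    (hd : Module.finrank ℂ X = d) {S : Set E} {U : Set X} (hU : IsOpen U) (hne : U.Nonempty)
    {φ : X → E} {ψ : E → X} (hφ : ∀ x ∈ U, DifferentiableAt ℂ φ x)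
    (hψ : ∀ x ∈ U, DifferentiableAt ℂ ψ (φ x)) (hinv : ∀ x ∈ U, ψ (φ x) = x)
    (hS : Set.MapsTo φ U S) : HasComplexDimAtLeast d S := by
  let L : (Fin d → ℂ) ≃L[ℂ] X := ContinuousLinearEquiv.ofFinrankEq (by simp [hd])
  have hφL : ∀ u ∈ L ⁻¹' U, DifferentiableAt ℂ (φ ∘ L) u := fun u hu =>
    (hφ (L u) hu).comp u L.differentiableAt
  have hopen : IsOpen (L ⁻¹' U) := hU.preimage L.continuous
  have hinvL : ∀ u ∈ L ⁻¹' U, L.symm (ψ ((φ ∘ L) u)) = u := fun u hu => by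
    rw [Function.comp_apply, hinv (L u) hu, L.symm_apply_apply]
  refine ⟨L ⁻¹' U, φ ∘ L, hopen, ?_, fun u hu => (hφL u hu).differentiableWithinAt, ?_, ?_, ?_⟩
  · obtain ⟨x, hx⟩ := hne
    exact ⟨L.symm x, by simpa using hx⟩
  · intro u hu v hv h
    rw [← hinvL u hu, ← hinvL v hv, h]
  · intro u hu
    have h1 : HasFDerivAt (fun u => L.symm (ψ ((φ ∘ L) u)))
        (((L.symm : X →L[ℂ] (Fin d → ℂ)).comp (fderiv ℂ ψ ((φ ∘ L) u))).comp
          (fderiv ℂ (φ ∘ L) u)) u :=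
      HasFDerivAt.comp u (g := fun v => L.symm (ψ v))
        (L.symm.hasFDerivAt.comp _ (hψ (L u) hu).hasFDerivAt) (hφL u hu).hasFDerivAt
    have h2 : HasFDerivAt (fun u => L.symm (ψ ((φ ∘ L) u))) (ContinuousLinearMap.id ℂ _) u :=
      (hasFDerivAt_id u).congr_of_eventuallyEq
        (Filter.eventually_of_mem (hopen.mem_nhds hu) hinvL)
    -- By the chain rule, the derivative of the left inverse is a left inverse of the derivative.
    have h3 := h1.unique h2
    intro v w hvw
    have h4 := congrArg (fun A => A v) h3
    have h5 := congrArg (fun A => A w) h3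
    simp only [ContinuousLinearMap.comp_apply, ContinuousLinearMap.id_apply] at h4 h5
    rw [← h4, hvw, h5]
  · exact fun u hu => hS hu

/-! ### Composition of the Möbius transformations and its closure -/

section Chain

/-- The product of the Möbius transformations `y ↦ s (T y + m) / (y + T)`. -/
def chain (T m s : ℕ → ℂ) : ℕ → Matrix (Fin 2) (Fin 2) ℂ
  | 0 => 1
  | k + 1 => !![s k * T k, s k * m k; 1, T k] * chain T m s k

variable {T m s : ℕ → ℂ}

theorem chain_congr {m' s' : ℕ → ℂ} {k : ℕ} (hm : ∀ j < k, m j = m' j) (hs : ∀ j < k, s j = s' j) :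
    chain T m s k = chain T m' s' k := by
  induction k with
  | zero => rfl
  | succ k ih =>
    rw [chain, chain, ih (fun j hj => hm j (by omega)) fun j hj => hs j (by omega),
      hm k (by omega), hs k (by omega)]

/-- Each factor has determinant `s (T² - m)`, so one of the nondegeneracy conditions is what makes
the Möbius maps invertible. -/
theorem chain_det_ne_zero {k : ℕ} (hs : ∀ j < k, s j ≠ 0) (hm : ∀ j < k, T j ^ 2 ≠ m j) :
    (chain T m s k).det ≠ 0 := by
  induction k with
  | zero => simp [chain]
  | succ k ih =>
    rw [chain, Matrix.det_mul, Matrix.det_fin_two_of]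
    refine mul_ne_zero ?_ (ih (fun j hj => hs j (by omega)) fun j hj => hm j (by omega))
    have h : s k * T k * T k - s k * m k * 1 = s k * (T k ^ 2 - m k) := by ring
    rw [h]
    exact mul_ne_zero (hs k (by omega)) (sub_ne_zero.2 (hm k (by omega)))

/-- A nonzero affine function has no zeros far out on the real line. -/
theorem eventually_affine_ne_zero {α β : ℂ} (h : α ≠ 0 ∨ β ≠ 0) :
    ∀ᶠ r : ℝ in Filter.atTop, α * (r : ℂ) + β ≠ 0 := by
  by_cases hα : α = 0
  · refine Filter.Eventually.of_forall fun r => ?_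
    simpa [hα] using h
  · filter_upwards [Filter.eventually_gt_atTop (-β / α).re] with r hr h0
    have : (r : ℂ) = -β / α := by
      rw [eq_div_iff hα]
      linear_combination h0
    rw [← this, Complex.ofReal_re] at hr
    exact lt_irrefl _ hr

theorem row_ne_zero_of_det_ne_zero {A : Matrix (Fin 2) (Fin 2) ℂ} (h : A.det ≠ 0) (i : Fin 2) :
    A i 0 ≠ 0 ∨ A i 1 ≠ 0 := by
  rw [Matrix.det_fin_two] at h
  by_contra! h'
  fin_cases i <;> simp_all

/-- The image of `w` under the Möbius transformation with matrix `A`. -/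
def mobius (A : Matrix (Fin 2) (Fin 2) ℂ) (w : ℂ) : ℂ :=
  (A 0 0 * w + A 0 1) / (A 1 0 * w + A 1 1)

theorem mobius_chain_succ {k : ℕ} {w : ℂ} (h1 : chain T m s k 1 0 * w + chain T m s k 1 1 ≠ 0) :
    mobius (chain T m s (k + 1)) w =
      s k * ((T k * mobius (chain T m s k) w + m k) / (mobius (chain T m s k) w + T k)) := by
  have e0 : ∀ j, chain T m s (k + 1) 0 j =
      s k * (T k * chain T m s k 0 j + m k * chain T m s k 1 j) := fun j => by
    simp [chain, Matrix.mul_apply, Fin.sum_univ_two]; ring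
  have e1 : ∀ j, chain T m s (k + 1) 1 j = chain T m s k 0 j + T k * chain T m s k 1 j :=
    fun j => by simp [chain, Matrix.mul_apply, Fin.sum_univ_two]
  set N := chain T m s k 0 0 * w + chain T m s k 0 1 with hN
  set Q := chain T m s k 1 0 * w + chain T m s k 1 1 with hQ
  have f1 : chain T m s (k + 1) 0 0 * w + chain T m s (k + 1) 0 1 = s k * (T k * N + m k * Q) := by
    rw [e0, e0, hN, hQ]; ring
  have f2 : chain T m s (k + 1) 1 0 * w + chain T m s (k + 1) 1 1 = N + T k * Q := by
    rw [e1, e1, hN, hQ]; ring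
  rw [mobius, mobius, f1, f2, ← hN, ← hQ]
  have g1 : T k * (N / Q) + m k = (T k * N + m k * Q) / Q := by field_simp
  have g2 : N / Q + T k = (N + T k * Q) / Q := by field_simp
  rw [g1, g2, div_div_div_cancel_right₀ h1, mul_div_assoc]

/-- If the composition of the Möbius transformations is the identity, then there is a path of closed
orbits. -/
theorem exists_path_of_chain_eq_smul_one {n : ℕ} (hs : ∀ j < n, s j ≠ 0)
    (hm : ∀ j < n, T j ^ 2 ≠ m j) {κ : ℂ} (hκ : chain T m s n = κ • 1) :
    ∃ y : unitInterval → ℕ → ℂ, (∀ k ≤ n, Continuous fun t => y t k) ∧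
      (∀ k ≤ n, ∀ t, y t k ≠ 0) ∧ (∀ k < n, ∀ t, y t k + T k ≠ 0) ∧
      (∀ k < n, ∀ t, y t (k + 1) = s k * ((T k * y t k + m k) / (y t k + T k))) ∧
      (∀ t, y t n = y t 0) ∧ ∀ t, y t 0 = y 0 0 → t = 0 := by
  have hdet : ∀ k ≤ n, (chain T m s k).det ≠ 0 := fun k hk =>
    chain_det_ne_zero (fun j hj => hs j (by omega)) fun j hj => hm j (by omega)
  -- Every coordinate of the orbit is a quotient of two affine functions of the starting value. They
  -- are not identically zero, since the matrices are invertible, and there are finitely many of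
  -- them; so a real ray avoids all zeros and poles.
  have hev : ∀ᶠ r : ℝ in Filter.atTop, ∀ k ∈ Finset.range (n + 1), ∀ i : Fin 2,
      chain T m s k i 0 * (r : ℂ) + chain T m s k i 1 ≠ 0 := by
    rw [Filter.eventually_all_finset]
    intro k hk
    rw [Filter.eventually_all]
    intro i
    exact eventually_affine_ne_zero
      (row_ne_zero_of_det_ne_zero (hdet k (by simpa [Nat.lt_succ_iff] using hk)) i)
  obtain ⟨R, hR⟩ := Filter.eventually_atTop.1 hev
  have hw : ∀ (t : unitInterval) (k : ℕ), k ≤ n → ∀ i : Fin 2,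
      chain T m s k i 0 * ((R + t : ℝ) : ℂ) + chain T m s k i 1 ≠ 0 := fun t k hk i =>
    hR (R + t) (by linarith [t.2.1]) k (by simpa [Nat.lt_succ_iff] using hk) i
  refine ⟨fun t k => mobius (chain T m s k) ((R + t : ℝ) : ℂ), fun k hk => ?_, fun k hk t => ?_,
    fun k hk t h0 => ?_, fun k hk t => ?_, fun t => ?_, fun t ht => ?_⟩
  · have hc : Continuous fun t : unitInterval => ((R + t : ℝ) : ℂ) := by fun_prop
    exact Continuous.div (by fun_prop) (by fun_prop) fun t => hw t k hk 1
  · exact div_ne_zero (hw t k hk 0) (hw t k hk 1)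
  -- A zero of `y + T` would be a zero of the next denominator.
  · refine hw t (k + 1) hk 1 ?_
    have h1 := hw t k hk.le 1
    simp only [mobius] at h0
    rw [div_add' _ _ _ h1, div_eq_zero_iff, or_iff_left h1] at h0
    simp only [chain, Matrix.mul_apply, Fin.sum_univ_two, Matrix.of_apply, Matrix.cons_val_one,
      Matrix.cons_val_zero, Matrix.cons_val_fin_one]
    linear_combination h0
  · exact mobius_chain_succ (hw t k hk.le 1)
  · have h := hdet n le_rfl
    have hκ0 : κ ≠ 0 := by
      rintro rfl
      simp [hκ] at h
    simp [hκ, mobius, chain, hκ0]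
  · simpa [mobius, chain] using ht

/-- The free part of a chain determines the last two twists and the last angle up to which it closes
up. -/
theorem exists_eq_smul_one {P : Matrix (Fin 2) (Fin 2) ℂ} {t m t' : ℂ} (ht' : t' ≠ 0)
    {a b c d : ℂ} (hG : !![t, m; 1, t] * P = !![a, b; c, d]) (ha : a ≠ 0) (hc : c ≠ 0) (hd : d ≠ 0) :
    ∃ κ : ℂ, !![-d / (c * t') * t', -d / (c * t') * (b * c * t' ^ 2 / (a * d)); 1, t'] *
      (!![-c * t' / a * t, -c * t' / a * m; 1, t] * P) = κ • 1 := by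
  have h1 : !![-c * t' / a * t, -c * t' / a * m; 1, t] =
      !![-c * t' / a, 0; 0, 1] * !![t, m; 1, t] := by simp
  -- Put `s`, `s'` for the last two twists and `m'` for the last angle. The lower left entry `s a +
  -- t' c` vanishes for `s = -c t' / a`; the upper right entry `s' (t' s b + m' d)` then vanishes
  -- for `m' = b c t'² / (a d)`; and the diagonal entries agree for `s' = -d / (c t')`.
  rw [h1, Matrix.mul_assoc, hG]
  refine ⟨t' / a * (a * d - b * c), ?_⟩
  ext i j
  fin_cases i <;> fin_cases j <;> simp <;> field_simp <;> ring

end Chain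

/-! ### Reading the parameters off the shape -/

section Recover
variable {n : ℕ} [NeZero n] {V : Fin n → EuclideanSpace ℝ (Fin 3)}

/-- The angle coordinate read off from a shape. -/
def recoverM (σ : Fin n → Fin 5 → ℂ) (i : Fin n) : ℂ := (1 - σ i 0) / (1 + σ i 0)

/-- The dihedral angle coordinate read off from a shape. -/
def ExteriorAngles.recoverS (D : ExteriorAngles V) (σ : Fin n → Fin 5 → ℂ) (i : Fin n) : ℂ :=
  ((-(σ i 3 * ((1 + recoverM σ i) * (1 + recoverM σ (i + 1)))) -
      (1 - recoverM σ i) * (1 - recoverM σ (i + 1))) / 4 +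
    Complex.I * (σ i 4 * ((1 + recoverM σ i) * (1 + recoverM σ (i + 1)))) / 4) /
      (recoverM σ i * D.twist i)

variable (D : ExteriorAngles V) {m s : Fin n → ℂ}

theorem one_add_div_ne_zero {m : ℂ} (hm : 1 + m ≠ 0) : 1 + (1 - m) / (1 + m) ≠ 0 := by
  rw [show 1 + (1 - m) / (1 + m) = 2 / (1 + m) by field_simp; ring]
  exact div_ne_zero two_ne_zero hm

theorem recoverM_shapeOf {i : Fin n} (hm : 1 + m i ≠ 0) : recoverM (D.shapeOf m s) i = m i := by
  have h := one_add_div_ne_zero hm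
  simp only [recoverM, ExteriorAngles.shapeOf, Matrix.cons_val_zero]
  rw [div_eq_iff h]
  field_simp
  ring

/-- With `q = twist i * s i`, the fourth and fifth entries of the shape give the sum and the
difference of `m i * q` and `m (i + 1) / q`, hence `m i * q` without any choice of a root. -/
theorem recoverS_shapeOf {i : Fin n} (hm : 1 + m i ≠ 0) (hm' : 1 + m (i + 1) ≠ 0) (h0 : m i ≠ 0) :
    D.recoverS (D.shapeOf m s) i = s i := by
  have ht := D.twist_ne_zero i
  have hI := Complex.I_sq
  rw [ExteriorAngles.recoverS, recoverM_shapeOf D hm, recoverM_shapeOf D hm',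
    div_eq_iff (mul_ne_zero h0 ht)]
  have e3 : D.shapeOf m s i 3 * ((1 + m i) * (1 + m (i + 1))) = -((1 - m i) * (1 - m (i + 1)) +
      2 * (m (i + 1) / (D.twist i * s i) + m i * (D.twist i * s i))) := by
    simp only [ExteriorAngles.shapeOf, Matrix.cons_val]
    rw [neg_mul, div_mul_cancel₀ _ (mul_ne_zero hm hm')]
  have e4 : D.shapeOf m s i 4 * ((1 + m i) * (1 + m (i + 1))) =
      -(2 * Complex.I * (m i * (D.twist i * s i) - m (i + 1) / (D.twist i * s i))) := by
    simp only [ExteriorAngles.shapeOf, Matrix.cons_val]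
    rw [neg_mul, div_mul_cancel₀ _ (mul_ne_zero hm hm')]
  rw [e3, e4]
  linear_combination (-(m i * (D.twist i * s i) - m (i + 1) / (D.twist i * s i)) / 2) * hI

theorem differentiableAt_recoverM_shapeOf {i : Fin n} (hm : 1 + m i ≠ 0) :
    DifferentiableAt ℂ (fun σ : Fin n → Fin 5 → ℂ => recoverM σ i) (D.shapeOf m s) := by
  have h : 1 + D.shapeOf m s i 0 ≠ 0 := one_add_div_ne_zero hm
  unfold recoverM
  fun_prop (disch := exact h)

theorem differentiableAt_recoverS_shapeOf {i : Fin n} (hm : 1 + m i ≠ 0) (hm' : 1 + m (i + 1) ≠ 0)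
    (h0 : m i ≠ 0) :
    DifferentiableAt ℂ (fun σ : Fin n → Fin 5 → ℂ => D.recoverS σ i) (D.shapeOf m s) := by
  have h1 := differentiableAt_recoverM_shapeOf D (s := s) hm
  have h2 := differentiableAt_recoverM_shapeOf D (s := s) hm'
  have h3 : recoverM (D.shapeOf m s) i * D.twist i ≠ 0 := by
    rw [recoverM_shapeOf D hm]
    exact mul_ne_zero h0 (D.twist_ne_zero i)
  unfold ExteriorAngles.recoverS
  fun_prop (disch := exact h3)

theorem differentiableAt_shapeOf {X : Type*} [NormedAddCommGroup X] [NormedSpace ℂ X]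
    {m s : X → Fin n → ℂ} {x : X} (hm : ∀ i, DifferentiableAt ℂ (fun x => m x i) x)
    (hs : ∀ i, DifferentiableAt ℂ (fun x => s x i) x) (hm0 : ∀ i, 1 + m x i ≠ 0)
    (hs0 : ∀ i, s x i ≠ 0) : DifferentiableAt ℂ (fun x => D.shapeOf (m x) (s x)) x := by
  rw [differentiableAt_pi]
  intro i
  rw [differentiableAt_pi]
  intro j
  have h1 := hm i
  have h2 := hm (i + 1)
  have h3 := hs i
  have h4 : DifferentiableAt ℂ (fun x => m x (i + 1) / (D.twist i * s x i)) x := by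
    fun_prop (disch := exact mul_ne_zero (D.twist_ne_zero i) (hs0 i))
  have h5 : DifferentiableAt ℂ (fun x => (1 - m x i) / (1 + m x i)) x := by
    fun_prop (disch := exact hm0 i)
  have h6 := mul_ne_zero (hm0 i) (hm0 (i + 1))
  fin_cases j
  · exact h5
  · exact h5
  · exact differentiableAt_const _
  · exact DifferentiableAt.neg (by fun_prop (disch := exact h6))
  · exact DifferentiableAt.neg (by fun_prop (disch := exact h6))

end Recover

/-! ### Holomorphic dependence on the parameters -/

/-- Extension of a finite sequence by zero. -/
def extend {k : ℕ} (f : Fin k → ℂ) (j : ℕ) : ℂ := if h : j < k then f ⟨j, h⟩ else 0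

theorem extend_of_lt {k : ℕ} (f : Fin k → ℂ) {j : ℕ} (h : j < k) : extend f j = f ⟨j, h⟩ :=
  dif_pos h

theorem differentiable_extend {X : Type*} [NormedAddCommGroup X] [NormedSpace ℂ X] {k : ℕ}
    {f : X → Fin k → ℂ} (hf : Differentiable ℂ f) (j : ℕ) :
    Differentiable ℂ fun x => extend (f x) j := by
  by_cases h : j < k
  · simp only [extend_of_lt _ h]
    fun_prop
  · simp only [extend, h, dif_neg, not_false_eq_true]
    fun_prop

theorem differentiable_chain {X : Type*} [NormedAddCommGroup X] [NormedSpace ℂ X] (T : ℕ → ℂ)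
    {m s : X → ℕ → ℂ} (hm : ∀ j, Differentiable ℂ fun x => m x j)
    (hs : ∀ j, Differentiable ℂ fun x => s x j) (k : ℕ) (i j : Fin 2) :
    Differentiable ℂ fun x => chain T (m x) (s x) k i j := by
  induction k generalizing i with
  | zero => exact differentiable_const _
  | succ k ih =>
    have h0 := ih 0
    have h1 := ih 1
    have h2 := hm k
    have h3 := hs k
    fin_cases i <;>
      simp only [chain, Matrix.mul_apply, Fin.sum_univ_two, Matrix.of_apply, Matrix.cons_val_zero,
        Matrix.cons_val_one, Matrix.cons_val_fin_one, Fin.zero_eta, Fin.mk_one] <;> fun_prop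

/-! ### Free parameters and the existence of generic ones -/

section Parameters
variable (N : ℕ) (T : ℕ → ℝ)

/-- The free parameters: all angles but the last, all twists but the last two. -/
abbrev Param : Type := (Fin (N + 2) → ℂ) × (Fin (N + 1) → ℂ)

variable {N}

/-- The part of the chain that depends on the free parameters only. -/
def freeChain (x : Param N) : Matrix (Fin 2) (Fin 2) ℂ :=
  !![(T (N + 1) : ℂ), extend x.1 (N + 1); 1, (T (N + 1) : ℂ)] *
    chain (fun k => (T k : ℂ)) (extend x.1) (extend x.2) (N + 1)

theorem differentiable_freeChain (i j : Fin 2) :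
    Differentiable ℂ fun x : Param N => freeChain T x i j := by
  have h1 : ∀ j, Differentiable ℂ fun x : Param N => extend x.1 j :=
    differentiable_extend differentiable_fst
  have h2 : ∀ j, Differentiable ℂ fun x : Param N => extend x.2 j :=
    differentiable_extend differentiable_snd
  have h3 := differentiable_chain (fun k => (T k : ℂ)) h1 h2 (N + 1)
  have h4 := h1 (N + 1)
  have h5 := h3 0
  have h6 := h3 1
  fin_cases i <;>
    simp only [freeChain, Matrix.mul_apply, Fin.sum_univ_two, Matrix.of_apply, Matrix.cons_val_zero,
      Matrix.cons_val_one, Matrix.cons_val_fin_one, Fin.zero_eta, Fin.mk_one] <;> fun_prop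

/-- All angle coordinates, the last of which is determined by closure. -/
def angleCoord (x : Param N) (k : ℕ) : ℂ :=
  if k < N + 2 then extend x.1 k else
    freeChain T x 0 1 * freeChain T x 1 0 * (T (N + 2) : ℂ) ^ 2 /
      (freeChain T x 0 0 * freeChain T x 1 1)

/-- All dihedral angle coordinates, the last two of which are determined by closure. -/
def twistCoord (x : Param N) (k : ℕ) : ℂ :=
  if k < N + 1 then extend x.2 k else
    if k = N + 1 then -freeChain T x 1 0 * (T (N + 2) : ℂ) / freeChain T x 0 0 else
      -freeChain T x 1 1 / (freeChain T x 1 0 * (T (N + 2) : ℂ))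

/-- The parameters that yield nondegenerate belts. -/
structure IsGeneric (x : Param N) : Prop where
  m_ne : ∀ k, x.1 k ≠ 0
  m_ne' : ∀ k, 1 + x.1 k ≠ 0
  sq_ne : ∀ k : Fin (N + 2), (T k : ℂ) ^ 2 - x.1 k ≠ 0
  sq_mul_ne : ∀ k : Fin (N + 2), (T k : ℂ) ^ 2 * x.1 k - 1 ≠ 0
  s_ne : ∀ k, x.2 k ≠ 0
  -- The last three conditions concern the quantities solved for: they are defined and nonzero, and
  -- the last `m` satisfies `1 + m ≠ 0` and `T² m ≠ 1`, written without denominators.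
  entry_ne : ∀ i j, freeChain T x i j ≠ 0
  last_ne' : freeChain T x 0 0 * freeChain T x 1 1 +
    (T (N + 2) : ℂ) ^ 2 * (freeChain T x 0 1 * freeChain T x 1 0) ≠ 0
  last_sq_mul_ne : freeChain T x 0 0 * freeChain T x 1 1 -
    (T (N + 2) : ℂ) ^ 4 * (freeChain T x 0 1 * freeChain T x 1 0) ≠ 0

theorem isOpen_isGeneric : IsOpen {x : Param N | IsGeneric T x} := by
  have hG : ∀ i j, Continuous fun x : Param N => freeChain T x i j := fun i j =>
    (differentiable_freeChain T i j).continuous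
  have h00 := hG 0 0
  have h01 := hG 0 1
  have h10 := hG 1 0
  have h11 := hG 1 1
  have key : ∀ {f : Param N → ℂ}, Continuous f → IsOpen {x | f x ≠ 0} := fun hf =>
    isOpen_ne_fun hf continuous_const
  have heq : {x : Param N | IsGeneric T x} =
      (⋂ k, {x | x.1 k ≠ 0}) ∩ (⋂ k, {x | 1 + x.1 k ≠ 0}) ∩
      (⋂ k : Fin (N + 2), {x | (T k : ℂ) ^ 2 - x.1 k ≠ 0}) ∩
      (⋂ k : Fin (N + 2), {x | (T k : ℂ) ^ 2 * x.1 k - 1 ≠ 0}) ∩ (⋂ k, {x | x.2 k ≠ 0}) ∩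
      (⋂ i, ⋂ j, {x | freeChain T x i j ≠ 0}) ∩
      {x | freeChain T x 0 0 * freeChain T x 1 1 +
        (T (N + 2) : ℂ) ^ 2 * (freeChain T x 0 1 * freeChain T x 1 0) ≠ 0} ∩
      {x | freeChain T x 0 0 * freeChain T x 1 1 -
        (T (N + 2) : ℂ) ^ 4 * (freeChain T x 0 1 * freeChain T x 1 0) ≠ 0} := by
    ext x
    simp only [Set.mem_ofPred_eq, Set.mem_inter_iff, Set.mem_iInter]
    exact ⟨fun ⟨a, b, c, d, e, f, g, h⟩ => ⟨⟨⟨⟨⟨⟨⟨a, b⟩, c⟩, d⟩, e⟩, f⟩, g⟩, h⟩,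
      fun ⟨⟨⟨⟨⟨⟨⟨a, b⟩, c⟩, d⟩, e⟩, f⟩, g⟩, h⟩ => ⟨a, b, c, d, e, f, g, h⟩⟩
  rw [heq]
  refine ((((((IsOpen.inter ?_ ?_).inter ?_).inter ?_).inter ?_).inter ?_).inter ?_).inter ?_
  · exact isOpen_iInter_of_finite fun k => key (by fun_prop)
  · exact isOpen_iInter_of_finite fun k => key (by fun_prop)
  · exact isOpen_iInter_of_finite fun k => key (by fun_prop)
  · exact isOpen_iInter_of_finite fun k => key (by fun_prop)
  · exact isOpen_iInter_of_finite fun k => key (by fun_prop)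
  · exact isOpen_iInter_of_finite fun i => isOpen_iInter_of_finite fun j => key (hG i j)
  · exact key (by fun_prop)
  · exact key (by fun_prop)

open scoped ComplexOrder in
theorem chain_pos {T m s : ℕ → ℂ} (hT : ∀ k, 0 < T k) {n : ℕ} (hm : ∀ k < n + 1, 0 < m k)
    (hs : ∀ k < n + 1, 0 < s k) (i j : Fin 2) : 0 < chain T m s (n + 1) i j := by
  induction n generalizing i with
  | zero =>
    have h1 := hT 0
    have h2 := hm 0 (by omega)
    have h3 := hs 0 (by omega)
    fin_cases i <;> fin_cases j <;> simp [chain] <;> positivity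
  | succ n ih =>
    have h1 := hT (n + 1)
    have h2 := hm (n + 1) (by omega)
    have h3 := hs (n + 1) (by omega)
    have h4 := ih (fun k hk => hm k (by omega)) (fun k hk => hs k (by omega)) 0
    have h5 := ih (fun k hk => hm k (by omega)) (fun k hk => hs k (by omega)) 1
    rw [chain, Matrix.mul_apply, Fin.sum_univ_two]
    fin_cases i <;> simp only [Matrix.of_apply, Matrix.cons_val_zero, Matrix.cons_val_one,
      Matrix.cons_val_fin_one, Fin.zero_eta, Fin.mk_one] <;> positivity

/-- The number `t² + t⁻² + 1` is a positive value of `m` that exceeds both forbidden values `t²` and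
`t⁻²`. -/
theorem sq_add_inv_sq_add_one_generic {t : ℝ} (ht : 0 < t) :
    (t : ℂ) ^ 2 - ((t ^ 2 + (t ^ 2)⁻¹ + 1 : ℝ) : ℂ) ≠ 0 ∧
      (t : ℂ) ^ 2 * ((t ^ 2 + (t ^ 2)⁻¹ + 1 : ℝ) : ℂ) - 1 ≠ 0 := by
  constructor
  · have h : 0 < (t ^ 2)⁻¹ := by positivity
    exact_mod_cast (show t ^ 2 - (t ^ 2 + (t ^ 2)⁻¹ + 1) ≠ 0 by linarith)
  · have h : t ^ 2 * (t ^ 2 + (t ^ 2)⁻¹ + 1) - 1 = t ^ 4 + t ^ 2 := by field_simp; ring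
    have h2 : t ^ 2 * (t ^ 2 + (t ^ 2)⁻¹ + 1) - 1 ≠ 0 := by rw [h]; positivity
    exact_mod_cast h2

open scoped ComplexOrder in
-- With all `m`, `s`, `T` positive, all matrix entries are positive, and most conditions hold at
-- once. The remaining ones are affine in the last free angle `r`, so a large `r` satisfies them.
theorem exists_isGeneric (hT : ∀ k, 0 < T k) : ∃ x : Param N, IsGeneric T x := by
  let m₀ : ℕ → ℝ := fun k => T k ^ 2 + (T k ^ 2)⁻¹ + 1
  have hm₀ : ∀ k, 0 < m₀ k := fun k => by have := hT k; positivity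
  have hT' : ∀ k, (0 : ℂ) < T k := fun k => by exact_mod_cast hT k
  have hm₀' : ∀ k, (0 : ℂ) < m₀ k := fun k => by exact_mod_cast hm₀ k
  set P := chain (fun k => (T k : ℂ)) (fun k => (m₀ k : ℂ)) (fun _ => 1) (N + 1) with hP
  have hPpos : ∀ i j, 0 < P i j := chain_pos hT' (fun k _ => hm₀' k) fun _ _ => one_pos
  have hPdet : P.det ≠ 0 := chain_det_ne_zero (fun _ _ => one_ne_zero) fun k _ =>
    sub_ne_zero.1 (sq_add_inv_sq_add_one_generic (hT k)).1
  set t : ℂ := (T (N + 1) : ℂ) with ht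
  set u : ℂ := (T (N + 2) : ℂ) with hu
  have htpos : 0 < t := hT' _
  have hupos : 0 < u := hT' _
  have h00 := hPpos 0 0
  have h01 := hPpos 0 1
  have h10 := hPpos 1 0
  have h11 := hPpos 1 1
  -- Only the upper row of the free chain depends on `r`, and it does so affinely; the expression in
  -- `last_sq_mul_ne` becomes `α r + β`.
  let α : ℂ := P 1 0 * (P 0 1 + t * P 1 1) - u ^ 4 * (P 1 1 * (P 0 0 + t * P 1 0))
  let β : ℂ := t * P 0 0 * (P 0 1 + t * P 1 1) - u ^ 4 * (t * P 0 1 * (P 0 0 + t * P 1 0))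
  have hαβ : α ≠ 0 ∨ β ≠ 0 := by
    by_contra! h
    obtain ⟨h1, h2⟩ := h
    apply hPdet
    -- The combination `P 1 1 * β - t * P 0 1 * α` equals `t (P 0 1 + t P 1 1) det P`, so `α` and
    -- `β` cannot both vanish.
    have h3 : 0 < t * (P 0 1 + t * P 1 1) := by positivity
    refine mul_left_cancel₀ h3.ne' ?_
    rw [Matrix.det_fin_two]
    linear_combination P 1 1 * h2 - t * P 0 1 * h1
  obtain ⟨r, ⟨hr0, hr1⟩, hr2, hr3⟩ := (((Filter.eventually_gt_atTop (0 : ℝ)).and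
    (eventually_affine_ne_zero hαβ)).and
    ((eventually_affine_ne_zero (α := -1) (β := t ^ 2) (Or.inl (by simp))).and
      (eventually_affine_ne_zero (α := t ^ 2) (β := -1) (Or.inr (by simp))))).exists
  have hr : (0 : ℂ) < r := by exact_mod_cast hr0
  let x : Param N := (fun k => if (k : ℕ) < N + 1 then (m₀ k : ℂ) else r, fun _ => 1)
  have hx1 : ∀ k : Fin (N + 2), 0 < x.1 k := fun k => by
    simp only [x]
    split_ifs
    · exact hm₀' _
    · exact hr
  have hchain : chain (fun k => (T k : ℂ)) (extend x.1) (extend x.2) (N + 1) = P := by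
    refine chain_congr (fun j hj => ?_) fun j hj => ?_
    · rw [extend_of_lt _ (by omega)]
      simp [x, hj]
    · rw [extend_of_lt _ hj]
  have hlast : extend x.1 (N + 1) = r := by
    rw [extend_of_lt _ (by omega)]
    simp [x]
  have e0 : ∀ j, freeChain T x 0 j = t * P 0 j + r * P 1 j := fun j => by
    simp [freeChain, hchain, hlast, Matrix.mul_apply, Fin.sum_univ_two, ht]
  have e1 : ∀ j, freeChain T x 1 j = P 0 j + t * P 1 j := fun j => by
    simp [freeChain, hchain, Matrix.mul_apply, Fin.sum_univ_two, ht]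
  refine ⟨x, fun k => (hx1 k).ne', fun k => (add_pos one_pos (hx1 k)).ne', fun k => ?_, fun k => ?_,
    fun k => one_ne_zero, fun i j => ?_, ?_, ?_⟩
  · by_cases hk : (k : ℕ) < N + 1
    · simp only [x, hk, if_true]
      exact (sq_add_inv_sq_add_one_generic (hT k)).1
    · have hk' : (k : ℕ) = N + 1 := by omega
      simp only [x, hk', lt_irrefl, if_false]
      convert hr2 using 1
      ring
  · by_cases hk : (k : ℕ) < N + 1
    · simp only [x, hk, if_true]
      exact (sq_add_inv_sq_add_one_generic (hT k)).2
    · have hk' : (k : ℕ) = N + 1 := by omega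
      simp only [x, hk', lt_irrefl, if_false]
      exact hr3
  · have h1 := hPpos 0 j
    have h2 := hPpos 1 j
    refine ne_of_gt ?_
    fin_cases i
    · exact (e0 j).symm ▸ by positivity
    · exact (e1 j).symm ▸ by positivity
  · rw [e0, e0, e1, e1]
    refine ne_of_gt ?_
    positivity
  · rw [e0, e0, e1, e1]
    convert hr1 using 1
    simp only [α, β]
    ring

end Parameters

/-! ### The closed chain and its nondegeneracy -/

section Closure
variable {N : ℕ} {T : ℕ → ℝ} {x : Param N}

theorem angleCoord_of_lt {k : ℕ} (h : k < N + 2) : angleCoord T x k = x.1 ⟨k, h⟩ := by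
  rw [angleCoord, if_pos h, extend_of_lt]

theorem twistCoord_of_lt {k : ℕ} (h : k < N + 1) : twistCoord T x k = x.2 ⟨k, h⟩ := by
  rw [twistCoord, if_pos h, extend_of_lt]

theorem angleCoord_last : angleCoord T x (N + 2) =
    freeChain T x 0 1 * freeChain T x 1 0 * (T (N + 2) : ℂ) ^ 2 /
      (freeChain T x 0 0 * freeChain T x 1 1) := by
  rw [angleCoord, if_neg (lt_irrefl _)]

theorem twistCoord_penultimate : twistCoord T x (N + 1) =
    -freeChain T x 1 0 * (T (N + 2) : ℂ) / freeChain T x 0 0 := by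
  rw [twistCoord, if_neg (lt_irrefl _), if_pos rfl]

theorem twistCoord_last : twistCoord T x (N + 2) =
    -freeChain T x 1 1 / (freeChain T x 1 0 * (T (N + 2) : ℂ)) := by
  rw [twistCoord, if_neg (by omega), if_neg (by omega)]

variable (hx : IsGeneric T x) (hT : ∀ k, 0 < T k)
include hx

theorem IsGeneric.det_ne_zero :
    freeChain T x 0 0 * freeChain T x 1 1 - freeChain T x 0 1 * freeChain T x 1 0 ≠ 0 := by
  rw [← Matrix.det_fin_two, freeChain, Matrix.det_mul, Matrix.det_fin_two_of]
  refine mul_ne_zero ?_ (chain_det_ne_zero (fun j hj => ?_) fun j hj => ?_)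
  · rw [extend_of_lt _ (by omega), mul_one, ← sq]
    exact hx.sq_ne ⟨N + 1, by omega⟩
  · rw [extend_of_lt _ hj]
    exact hx.s_ne _
  · rw [extend_of_lt _ (by omega)]
    exact sub_ne_zero.1 (hx.sq_ne ⟨j, by omega⟩)

include hT

theorem IsGeneric.angleCoord_spec {k : ℕ} (hk : k < N + 3) :
    angleCoord T x k ≠ 0 ∧ 1 + angleCoord T x k ≠ 0 ∧ (T k : ℂ) ^ 2 ≠ angleCoord T x k ∧
      (T k : ℂ) ^ 2 * angleCoord T x k ≠ 1 := by
  rcases Nat.lt_succ_iff_lt_or_eq.1 hk with h | rfl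
  · rw [angleCoord_of_lt h]
    exact ⟨hx.m_ne _, hx.m_ne' _, sub_ne_zero.1 (hx.sq_ne ⟨k, h⟩),
      sub_ne_zero.1 (hx.sq_mul_ne ⟨k, h⟩)⟩
  · have hu : (T (N + 2) : ℂ) ≠ 0 := Complex.ofReal_ne_zero.2 (hT _).ne'
    have hd := hx.det_ne_zero
    have h1 := hx.last_ne'
    have h2 := hx.last_sq_mul_ne
    have h3 := mul_ne_zero (hx.entry_ne 0 0) (hx.entry_ne 1 1)
    rw [angleCoord_last]
    refine ⟨div_ne_zero (mul_ne_zero (mul_ne_zero (hx.entry_ne 0 1) (hx.entry_ne 1 0))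
      (pow_ne_zero 2 hu)) h3, ?_, ?_, ?_⟩
    · rw [← div_self h3, ← add_div]
      refine div_ne_zero ?_ h3
      convert h1 using 1
      ring
    -- For the last angle, `T² = m` would mean that the free chain is singular.
    · rw [Ne, eq_div_iff h3]
      intro h
      exact hd (mul_left_cancel₀ (pow_ne_zero 2 hu) (by linear_combination h))
    · rw [Ne, mul_div_assoc', div_eq_one_iff_eq h3]
      intro h
      exact h2 (by linear_combination -h)

theorem IsGeneric.twistCoord_ne_zero {k : ℕ} (hk : k < N + 3) : twistCoord T x k ≠ 0 := by
  have hu : (T (N + 2) : ℂ) ≠ 0 := Complex.ofReal_ne_zero.2 (hT _).ne'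
  have hG := hx.entry_ne
  rcases Nat.lt_succ_iff_lt_or_eq.1 hk with h | rfl
  · rcases Nat.lt_succ_iff_lt_or_eq.1 h with h' | rfl
    · rw [twistCoord_of_lt h']
      exact hx.s_ne _
    · rw [twistCoord_penultimate]
      exact div_ne_zero (mul_ne_zero (neg_ne_zero.2 (hG 1 0)) hu) (hG 0 0)
  · rw [twistCoord_last]
    exact div_ne_zero (neg_ne_zero.2 (hG 1 1)) (mul_ne_zero (hG 1 0) hu)

theorem IsGeneric.exists_chain_eq_smul_one : ∃ κ : ℂ,
    chain (fun k => (T k : ℂ)) (angleCoord T x) (twistCoord T x) (N + 3) = κ • 1 := by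
  have hu : (T (N + 2) : ℂ) ≠ 0 := Complex.ofReal_ne_zero.2 (hT _).ne'
  have hfree : chain (fun k => (T k : ℂ)) (angleCoord T x) (twistCoord T x) (N + 1) =
      chain (fun k => (T k : ℂ)) (extend x.1) (extend x.2) (N + 1) :=
    chain_congr (fun j hj => by rw [angleCoord, if_pos (by omega)])
      fun j hj => by rw [twistCoord, if_pos hj]
  have hG : !![(T (N + 1) : ℂ), angleCoord T x (N + 1); 1, (T (N + 1) : ℂ)] *
      chain (fun k => (T k : ℂ)) (angleCoord T x) (twistCoord T x) (N + 1) =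
      !![freeChain T x 0 0, freeChain T x 0 1; freeChain T x 1 0, freeChain T x 1 1] := by
    rw [← Matrix.eta_fin_two, freeChain, hfree, angleCoord, if_pos (by omega)]
  obtain ⟨κ, hκ⟩ := exists_eq_smul_one hu hG (hx.entry_ne 0 0) (hx.entry_ne 1 0) (hx.entry_ne 1 1)
  refine ⟨κ, ?_⟩
  rw [chain, chain, angleCoord_last, twistCoord_last, twistCoord_penultimate]
  exact hκ

omit hT in
theorem IsGeneric.differentiableAt_angleCoord (k : ℕ) :
    DifferentiableAt ℂ (fun x : Param N => angleCoord T x k) x := by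
  have hG := fun i j => (differentiable_freeChain (N := N) T i j).differentiableAt (x := x)
  have h00 := hG 0 0
  have h01 := hG 0 1
  have h10 := hG 1 0
  have h11 := hG 1 1
  by_cases h : k < N + 2
  · simp only [angleCoord, if_pos h]
    exact differentiable_extend differentiable_fst k x
  · simp only [angleCoord, if_neg h]
    fun_prop (disch := exact mul_ne_zero (hx.entry_ne 0 0) (hx.entry_ne 1 1))

theorem IsGeneric.differentiableAt_twistCoord (k : ℕ) :
    DifferentiableAt ℂ (fun x : Param N => twistCoord T x k) x := by
  have hu : (T (N + 2) : ℂ) ≠ 0 := Complex.ofReal_ne_zero.2 (hT _).ne'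
  have hG := fun i j => (differentiable_freeChain (N := N) T i j).differentiableAt (x := x)
  have h00 := hG 0 0
  have h10 := hG 1 0
  have h11 := hG 1 1
  by_cases h : k < N + 1
  · simp only [twistCoord, if_pos h]
    exact differentiable_extend differentiable_snd k x
  · by_cases h' : k = N + 1
    · simp only [twistCoord, if_neg h, if_pos h']
      fun_prop (disch := exact hx.entry_ne 0 0)
    · simp only [twistCoord, if_neg h, if_neg h']
      fun_prop (disch := exact mul_ne_zero (hx.entry_ne 1 0) hu)

end Closure

/-! ### Flexible belts from generic parameters -/

section Belts
variable {N : ℕ} {V : Fin (N + 3) → EuclideanSpace ℝ (Fin 3)}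

/-- The half-angle tangents of the polygon, indexed by the natural numbers. -/
def ExteriorAngles.TNat (D : ExteriorAngles V) (k : ℕ) : ℝ :=
  if h : k < N + 3 then D.T ⟨k, h⟩ else 1

/-- The default value `1` beyond the polygon makes positivity hold for every natural index. -/
theorem ExteriorAngles.TNat_pos (D : ExteriorAngles V) (k : ℕ) : 0 < D.TNat k := by
  unfold TNat
  split_ifs
  · exact D.T_pos _
  · exact one_pos

theorem ExteriorAngles.TNat_val (D : ExteriorAngles V) (i : Fin (N + 3)) : D.TNat i = D.T i :=
  dif_pos i.2

/-- The coordinates of generic parameters are realized by flexible belts. -/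
theorem IsGeneric.exists_belt (D : ExteriorAngles V) {x : Param N} (hx : IsGeneric D.TNat x) :
    ∃ β : Belt V, (β.IsIsogonal ∧ β.IsNondegenerate ∧ β.IsFlexible) ∧
      β.shape = D.shapeOf (fun i => angleCoord D.TNat x i) fun i => twistCoord D.TNat x i := by
  have hT := D.TNat_pos
  have hm := fun (i : Fin (N + 3)) => hx.angleCoord_spec hT i.2
  have hs := fun (i : Fin (N + 3)) => hx.twistCoord_ne_zero hT i.2
  obtain ⟨κ, hκ⟩ := hx.exists_chain_eq_smul_one hT
  obtain ⟨y, hyc, hy0, hyT, hrec, hcl, hinj⟩ := exists_path_of_chain_eq_smul_one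
    (fun j hj => hx.twistCoord_ne_zero hT hj) (fun j hj => (hx.angleCoord_spec hT hj).2.2.1) hκ
  let z : unitInterval → Fin (N + 3) → ℂ := fun t i => y t (i + 1) / twistCoord D.TNat x i
  have hcoord : ∀ t, D.IsCoord (fun i => angleCoord D.TNat x i) (fun i => y t i) (z t) := fun t =>
    { m_ne := fun i => (hm i).1
      m_ne' := fun i => (hm i).2.1
      y_ne := fun i => hy0 i i.2.le t
      z_ne := fun i => div_ne_zero (hy0 _ i.2 t) (hs i)
      rel := fun i => by
        have h := hyT i i.2 t
        simp only [z, hrec i i.2 t, mul_div_cancel_left₀ _ (hs i)]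
        rw [D.TNat_val] at h ⊢
        exact div_mul_cancel₀ _ h }
  have hstep : ∀ t (i : Fin (N + 3)),
      y t ((i + 1 : Fin (N + 3)) : ℕ) = twistCoord D.TNat x i * z t i := by
    intro t i
    simp only [z]
    rw [mul_div_cancel₀ _ (hs i)]
    -- At the last vertex the index wraps around to `0`, and the step is the closing of the orbit.
    by_cases hi : i = Fin.last (N + 2)
    · subst hi
      rw [Fin.last_add_one, Fin.val_last]
      exact (hcl t).symm
    · rw [Fin.val_add_one_of_lt (Fin.lt_last_iff_ne_last.2 hi)]
  refine ⟨(hcoord 0).belt, ⟨(hcoord 0).isIsogonal, (hcoord 0).isNondegenerate (fun i => ?_)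
    fun i => ?_, ?_⟩, (hcoord 0).shape_eq (hstep 0)⟩
  · rw [← D.TNat_val]
    exact (hm i).2.2.1
  · rw [← D.TNat_val]
    exact (hm i).2.2.2
  · refine ExteriorAngles.isFlexible_of_path hcoord hstep
      (continuous_pi fun i => hyc i i.2.le) (continuous_pi fun i => ?_) 0 fun t ht => hinj t ht
    exact (hyc _ i.2).div_const _

theorem hasComplexDimAtLeast_shape (D : ExteriorAngles V) :
    HasComplexDimAtLeast (2 * (N + 3) - 3) (Belt.shape ''
      {β : Belt V | β.IsIsogonal ∧ β.IsNondegenerate ∧ β.IsFlexible}) := by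
  have hT := D.TNat_pos
  refine hasComplexDimAtLeast_of_leftInverse (X := Param N) (U := {x | IsGeneric D.TNat x})
    (φ := fun x => D.shapeOf (fun i => angleCoord D.TNat x i) fun i => twistCoord D.TNat x i)
    -- The left inverse only has to return the free coordinates: all `m` but the last, all `s` but
    -- the last two.
    (ψ := fun σ => (fun k => recoverM σ k.castSucc, fun k => D.recoverS σ k.castSucc.castSucc))
    ?_ (isOpen_isGeneric _) (exists_isGeneric _ hT) (fun x hx => ?_) (fun x hx => ?_)
    (fun x hx => ?_) fun x hx => ?_
  · simp only [Param, Module.finrank_prod, Module.finrank_fin_fun]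
    omega
  · exact differentiableAt_shapeOf D (fun i => hx.differentiableAt_angleCoord i)
      (fun i => hx.differentiableAt_twistCoord hT i) (fun i => (hx.angleCoord_spec hT i.2).2.1)
      fun i => hx.twistCoord_ne_zero hT i.2
  · have h0 := fun (i : Fin (N + 3)) => (hx.angleCoord_spec hT i.2).1
    have h1 := fun (i : Fin (N + 3)) => (hx.angleCoord_spec hT i.2).2.1
    refine DifferentiableAt.prodMk ?_ ?_ <;> rw [differentiableAt_pi] <;> intro k
    · exact differentiableAt_recoverM_shapeOf D (h1 _)
    · exact differentiableAt_recoverS_shapeOf D (h1 _) (h1 _) (h0 _)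
  · have h0 := fun (i : Fin (N + 3)) => (hx.angleCoord_spec hT i.2).1
    have h1 := fun (i : Fin (N + 3)) => (hx.angleCoord_spec hT i.2).2.1
    refine Prod.ext (funext fun k => ?_) (funext fun k => ?_)
    · exact (recoverM_shapeOf D (h1 _)).trans (angleCoord_of_lt k.2)
    · exact (recoverS_shapeOf D (h1 _) (h1 _) (h0 _)).trans (twistCoord_of_lt k.2)
  · obtain ⟨β, hβ, hshape⟩ := hx.exists_belt D
    exact ⟨β, hβ, hshape⟩

end Belts
end Kokotsakis

end

theorem theorem1 (n : ℕ) [NeZero n] (hn : 3 ≤ n)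
    (V : Fin n → EuclideanSpace ℝ (Fin 3))
    (hV : ∀ i, AffineIndependent ℝ ![V (i - 1), V i, V (i + 1)]) :
    Kokotsakis.HasComplexDimAtLeast (2 * n - 3)
      (Kokotsakis.Belt.shape ''
        {β : Kokotsakis.Belt V | β.IsIsogonal ∧ β.IsNondegenerate ∧ β.IsFlexible}) := by
  obtain ⟨N, rfl⟩ := Nat.exists_eq_add_of_le' hn
  obtain ⟨D⟩ := Kokotsakis.nonempty_exteriorAngles hV
  exact Kokotsakis.hasComplexDimAtLeast_shape D
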